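/- Let $r\ge 5$ be odd and let $e_1,\dots,e_r$ be the standard orthonormal basis of $\mathbb R^r$. Let $W(D_r)$ be the group of signed permutations $e_j\mapsto \varepsilon_j e_{\pi(j)}$ ($\pi\in S_r$, $\varepsilon_j\in\{\pm1\}$) with an even number of sign changes. Its positive roots are $\Pi_+=\{e_i-e_j,\ e_i+e_j: 1\le i<j\le r\}$ and its simple roots are $\alpha_i=e_i-e_{i+1}$ ($1\le i\le r-1$) and $\alpha_r=e_{r-1}+e_r$. For positive roots write $\rho\le\eta$ if $\eta-\rho\in\sum_a\mathbb Z_{\ge0}\alpha_a$, and for $S\subseteq\Pi_+$ put $\mathrm{Adj}(S)=\{\gamma\in\Pi_+:\gamma\le\beta\text{ for some }\beta\in S\}$. For $u\in W(D_r)$ let $\nu_0(u)=u(\Pi_+)\cap\Pi_+$ and $\nu_k(u)=u(\mathrm{Adj}(\nu_{k-1}(u)))\cap\Pi_+$ for $k\ge1$; $u$ is called rational if $\nu_k(u)=\varnothing$ for all sufficiently large $k$. Let $\Gamma(D_r)$ be the graph whose vertices are the rational elements of $W(D_r)$, two vertices being adjacent (written $\sim$) when they differ by left multiplication by a simple reflection.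 Let $w_0$ be the longest element: $w_0(e_i)=-e_i$ for $i\le r-1$, and $w_0(e_r)=e_r$. For a non-empty $I=\{i_1<\dots<i_k\}\subseteq\{1,\dots,r-1\}$ let $p_I\in S_r$ be the cycle $i_1\mapsto i_2\mapsto\cdots\mapsto i_k\mapsto r\mapsto i_1$, and define $$c_I(e_j)=-e_{p_I(j)}\ (1\le j\le r-1),\qquad c_I(e_r)=e_{i_1},$$ $$d_I(e_j)=-e_{p_I(j)}\ (1\le j\le r-1,\ j\ne i_k),\qquad d_I(e_{i_k})=e_r,\qquad d_I(e_r)=-e_{i_1}.$$ Put $c_\varnothing=d_\varnothing=w_0$. Then the rational elements of $W(D_r)$ are precisely the elements of $$\mathcal F_r=\{w_0\}\cup\{c_I,d_I:\varnothing\ne I\subseteq\{1,\dots,r-1\}\},$$ and $\#\mathcal F_r=1+2(2^{r-1}-1)=2^r-1$. Moreover, for all $I\subseteq\{1,\dots,r-1\}$ and $1\le a\le r-2$, $$c_I\sim c_{I\triangle\{a\}}\iff a+1\in I,\qquad d_I\sim d_{I\triangle\{a\}}\iff a+1\in I,$$ and $c_I\sim c_{I\triangle\{r-1\}}$, $d_I\sim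 d_{I\triangle\{r-1\}}$ for all $I\subseteq\{1,\dots,r-1\}$. The graph $\Gamma(D_r)$ has no other edges. In particular, $c_{\{1\}}$ and $d_{\{1\}}$ are the only vertices of valency one in $\Gamma(D_r)$. -/

import Mathlib

/-! Rank `r = n + 1`.  The index `i : Fin (n + 1)` stands for the number `i + 1 ∈ {1, …, r}`;
`Fin.last n` stands for `r`, and `Fin n` stands for `{1, …, r - 1}`. -/

namespace TypeD

/-- The space `ℝ ^ r`, `r = n + 1`, with its standard basis and the standard dot product. -/
abbrev V (n : ℕ) : Type := Fin (n + 1) → ℝ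

/-- The standard basis vectors. -/
def e {n : ℕ} (i : Fin (n + 1)) : V n := Pi.single i 1

/-- The signed permutation `e j ↦ ε j • e (π j)` as a linear automorphism of `ℝ ^ r`. -/
def signedPerm {n : ℕ} (π : Equiv.Perm (Fin (n + 1))) (ε : Fin (n + 1) → ℤˣ) :
    V n ≃ₗ[ℝ] V n where
  toFun x i := ((ε (π.symm i) : ℤ) : ℝ) * x (π.symm i)
  invFun x j := ((ε j : ℤ) : ℝ) * x (π j)
  map_add' x y := by ext i; simp [mul_add]
  map_smul' t x := by ext i; simp [mul_left_comm]
  left_inv x := by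
    ext j
    rcases Int.units_eq_one_or (ε j) with h | h <;> simp [h]
  right_inv x := by
    ext i
    rcases Int.units_eq_one_or (ε (π.symm i)) with h | h <;> simp [h]

theorem signedPerm_e {n : ℕ} (π : Equiv.Perm (Fin (n + 1))) (ε : Fin (n + 1) → ℤˣ)
    (j : Fin (n + 1)) : signedPerm π ε (e j) = ((ε j : ℤ) : ℝ) • e (π j) := by
  ext i
  by_cases h : i = π j
  · subst h; simp [signedPerm, e]
  · have h' : π.symm i ≠ j := fun h'' => h (by simp [← h''])
    simp [signedPerm, e, h, h']

theorem even_iff_prod {n : ℕ} (ε : Fin (n + 1) → ℤˣ) :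
    Even (Finset.univ.filter fun j => ε j = -1).card ↔ ∏ j, ε j = 1 := by
  have h : ∏ j, ε j = (-1) ^ (Finset.univ.filter fun j => ε j = -1).card := by
    rw [← Finset.prod_const, Finset.prod_filter]
    refine Finset.prod_congr rfl fun j _ => ?_
    rcases Int.units_eq_one_or (ε j) with h | h <;> simp [h]
  rw [h]
  rcases Nat.even_or_odd (Finset.univ.filter fun j => ε j = -1).card with h' | h'
  · simp [h', h'.neg_one_pow]
  · simp [Nat.not_even_iff_odd.mpr h', h'.neg_one_pow]

/-- The Weyl group `W(D_r)`: signed permutations with an even number of sign changes. -/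
def W (n : ℕ) : Subgroup (V n ≃ₗ[ℝ] V n) where
  carrier := {u | ∃ (π : Equiv.Perm (Fin (n + 1))) (ε : Fin (n + 1) → ℤˣ),
    Even (Finset.univ.filter fun j => ε j = -1).card ∧ u = signedPerm π ε}
  one_mem' := ⟨1, 1, by simp, by apply LinearEquiv.ext; intro x; ext i; simp [signedPerm]; rfl⟩
  mul_mem' := by
    rintro _ _ ⟨π, ε, h, rfl⟩ ⟨π', ε', h', rfl⟩
    refine ⟨π * π', fun j => ε (π' j) * ε' j, ?_, ?_⟩
    · rw [even_iff_prod] at *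
      rw [Finset.prod_mul_distrib, h', Equiv.prod_comp π' ε, h, one_mul]
    · apply LinearEquiv.ext
      intro x
      ext i
      simp [signedPerm, mul_assoc]
      simp [Equiv.Perm.mul_def]
  inv_mem' := by
    rintro _ ⟨π, ε, h, rfl⟩
    refine ⟨π⁻¹, fun j => ε (π⁻¹ j), ?_, ?_⟩
    · rw [even_iff_prod] at *
      rw [Equiv.prod_comp π⁻¹ ε, h]
    · apply LinearEquiv.ext
      intro x
      rw [LinearEquiv.coe_inv, LinearEquiv.symm_apply_eq]
      ext i
      rcases Int.units_eq_one_or (ε (π.symm i)) with h | h <;>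
        simp [signedPerm, h, Equiv.Perm.inv_def]

/-- The positive roots `e_i - e_j` and `e_i + e_j`, `i < j`. -/
def posRoots (n : ℕ) : Set (V n) :=
  {x | ∃ i j : Fin (n + 1), i < j ∧ x = e i - e j} ∪
    {x | ∃ i j : Fin (n + 1), i < j ∧ x = e i + e j}

/-- The simple roots `e_i - e_{i+1}` for `1 ≤ i ≤ r - 1`, and `e_{r-1} + e_r`. -/
def simpleRoots (n : ℕ) : Set (V n) :=
  {x | ∃ i : Fin n, x = e i.castSucc - e i.succ} ∪
    {x | ∃ i : Fin n, i.succ = Fin.last n ∧ x = e i.castSucc + e i.succ}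

/-- The root order: `η - ρ` is a sum of simple roots with coefficients in `ℕ`. -/
def RootLE {n : ℕ} (ρ η : V n) : Prop := η - ρ ∈ AddSubmonoid.closure (simpleRoots n)

/-- The positive roots below some element of `S`. -/
def adj {n : ℕ} (S : Set (V n)) : Set (V n) :=
  {γ | γ ∈ posRoots n ∧ ∃ β ∈ S, RootLE γ β}

/-- The descending sequence `ν_k(u)`. -/
def nu {n : ℕ} (u : V n ≃ₗ[ℝ] V n) : ℕ → Set (V n)
  | 0 => u '' posRoots n ∩ posRoots n
  | k + 1 => u '' adj (nu u k) ∩ posRoots n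

/-- `u` is a rational element of the Weyl group `W(D_r)`. -/
def IsRational {n : ℕ} (u : V n ≃ₗ[ℝ] V n) : Prop :=
  u ∈ W n ∧ ∃ N : ℕ, ∀ k ≥ N, nu u k = ∅

/-- The orthogonal reflection in the hyperplane perpendicular to `α`. -/
noncomputable def reflect {n : ℕ} (α x : V n) : V n := x - (2 * (x ⬝ᵥ α) / (α ⬝ᵥ α)) • α

/-- The graph `Γ(D_r)`: its vertices are the rational elements of `W(D_r)`, and two distinct
vertices are adjacent when one is `s_α` times the other, for a simple root `α`. -/
def rationalityGraph (n : ℕ) : SimpleGraph {u : V n ≃ₗ[ℝ] V n // IsRational u} :=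
  SimpleGraph.fromRel fun u v => ∃ α ∈ simpleRoots n, ∀ x, v.1 x = reflect α (u.1 x)

/-- `w_0`: `e_j ↦ -e_j` for `j < r`, and `e_r ↦ e_r`. -/
def w0 (n : ℕ) : V n ≃ₗ[ℝ] V n :=
  signedPerm 1 fun j => if j = Fin.last n then 1 else -1

/-- The cycle `p_I = (i_1 i_2 ⋯ i_k r)` for `I = {i_1 < ⋯ < i_k} ⊆ {1, …, r - 1}`. -/
def p {n : ℕ} (I : Finset (Fin n)) : Equiv.Perm (Fin (n + 1)) :=
  ((I.sort (· ≤ ·)).map Fin.castSucc ++ [Fin.last n]).formPerm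

/-- For non-empty `I`: `c_I(e_j) = -e_{p_I(j)}` for `j < r`, and `c_I(e_r) = e_{i_1}`
(here `i_1 = p_I(r)`).  By convention `c_∅ = w_0`. -/
def c {n : ℕ} (I : Finset (Fin n)) : V n ≃ₗ[ℝ] V n :=
  if I.Nonempty then signedPerm (p I) fun j => if j = Fin.last n then 1 else -1
  else w0 n

/-- For non-empty `I` with maximum `i_k`: `d_I(e_j) = -e_{p_I(j)}` for `j ≠ i_k`
(so `d_I(e_r) = -e_{i_1}`), and `d_I(e_{i_k}) = e_r`.  By convention `d_∅ = w_0`. -/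
def d {n : ℕ} (I : Finset (Fin n)) : V n ≃ₗ[ℝ] V n :=
  if h : I.Nonempty then signedPerm (p I) fun j => if j = (I.max' h).castSucc then 1 else -1
  else w0 n

end TypeD

/-! Write `u = signedPerm π ε`, with r the last index. A nonempty set `S` of positive roots with `S
⊆ u '' adj S` lies in every `nu u k`, so a single positive root lying below its own positive image,
or a pair lying below each other's images, rules out rationality. Testing this on e_a ± e_r and e_i
- e_a shows that a rational `u` has `π j ≥ j` for every j ≠ r (`IsRational.isUp`) and that a plus
sign can occur only at r or at the index sent to r (`IsRational.apply_eq_last`). Counting shows that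
a permutation with `IsUp` has no moved index strictly between i and π i, so it is an increasing
cycle through r, fixed by its moved set I: it is `p I` (`IsUp.eq_p`). As r is odd and the number of
minus signs is even, there is exactly one plus sign: at r it gives `c I`, at the preimage of r it
gives `d I`.

Conversely, for `u = c I` coordinate sums of images of positive roots are at most 0, so only roots
e_i - e_j matter, and partial coordinate sums give `nu u 2 = ∅` (`IsUp.nu_two_eq_empty`).
Conjugation by the diagram automorphism e_r ↦ -e_r preserves rationality and exchanges `c I` and `d
I`, so everything about d follows from c.

A reflection in e_a - e_{a+1} multiplies `p I` on the left by a transposition and keeps the signs.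
The product still satisfies `IsUp` exactly when a + 1 lies on the cycle or is r, and it is then `p`
of I with a toggled. The remaining simple reflection leads from `c I` to a rational element only at
`I = ∅`, where the c and d halves of the graph meet. -/

namespace TypeD

variable {n : ℕ}

/-! ### Signed permutations -/

theorem signedPerm_apply (π : Equiv.Perm (Fin (n + 1))) (ε : Fin (n + 1) → ℤˣ) (x : V n)
    (i : Fin (n + 1)) :
    signedPerm π ε x i = ((ε (π.symm i) : ℤ) : ℝ) * x (π.symm i) := rfl

theorem signedPerm_signedPerm (π π' : Equiv.Perm (Fin (n + 1))) (ε ε' : Fin (n + 1) → ℤˣ)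
    (x : V n) :
    signedPerm π ε (signedPerm π' ε' x) = signedPerm (π * π') (fun j => ε (π' j) * ε' j) x := by
  ext i
  simp [signedPerm_apply, mul_assoc, Equiv.Perm.mul_def]

theorem signedPerm_e_of_eq_one {π : Equiv.Perm (Fin (n + 1))} {ε : Fin (n + 1) → ℤˣ}
    {j : Fin (n + 1)} (h : ε j = 1) : signedPerm π ε (e j) = e (π j) := by
  simp [signedPerm_e, h]

theorem signedPerm_e_of_eq_neg_one {π : Equiv.Perm (Fin (n + 1))} {ε : Fin (n + 1) → ℤˣ}
    {j : Fin (n + 1)} (h : ε j = -1) : signedPerm π ε (e j) = -e (π j) := by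
  simp [signedPerm_e, h]

theorem signedPerm_injective {π π' : Equiv.Perm (Fin (n + 1))} {ε ε' : Fin (n + 1) → ℤˣ}
    (h : signedPerm π ε = signedPerm π' ε') : π = π' ∧ ε = ε' := by
  have key : ∀ j, π j = π' j ∧ ε j = ε' j := by
    intro j
    have hj : signedPerm π ε (e j) = signedPerm π' ε' (e j) := by rw [h]
    rw [signedPerm_e, signedPerm_e] at hj
    have hj' := congrFun hj (π j)
    by_cases hp : π j = π' j
    · refine ⟨hp, ?_⟩
      rw [← hp] at hj'
      simp only [e, Pi.smul_apply, Pi.single_eq_same, smul_eq_mul, mul_one] at hj'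
      exact Units.ext (by exact_mod_cast hj')
    · simp [e, hp] at hj'
  exact ⟨Equiv.ext fun j => (key j).1, funext fun j => (key j).2⟩

/-! ### The root order -/

theorem posRoot_sub {i j : Fin (n + 1)} (h : i < j) : e i - e j ∈ posRoots n :=
  Or.inl ⟨i, j, h, rfl⟩

theorem posRoot_add {i j : Fin (n + 1)} (h : i ≠ j) : e i + e j ∈ posRoots n := by
  rcases lt_or_gt_of_ne h with h | h
  · exact Or.inr ⟨i, j, h, rfl⟩
  · exact Or.inr ⟨j, i, h, add_comm _ _⟩

theorem sub_mem_cone {i j : Fin (n + 1)} (h : i ≤ j) :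
    e i - e j ∈ AddSubmonoid.closure (simpleRoots n) := by
  induction j using Fin.induction with
  | zero => simp [Fin.le_zero_iff.mp h]
  | succ j ih =>
    rcases h.eq_or_lt with rfl | h
    · simp
    · have h' : i ≤ j.castSucc := Fin.le_castSucc_iff.mpr h
      have hs : e j.castSucc - e j.succ ∈ AddSubmonoid.closure (simpleRoots n) :=
        AddSubmonoid.subset_closure (Or.inl ⟨j, rfl⟩)
      have := add_mem (ih h') hs
      rwa [sub_add_sub_cancel] at this

theorem add_last_mem_cone {i : Fin (n + 1)} (h : i ≠ Fin.last n) :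
    e i + e (Fin.last n) ∈ AddSubmonoid.closure (simpleRoots n) := by
  cases n with
  | zero => exact absurd (Subsingleton.elim (α := Fin 1) _ _) h
  | succ m =>
    have hs : e (Fin.last m).castSucc + e (Fin.last m).succ ∈
        AddSubmonoid.closure (simpleRoots (m + 1)) :=
      AddSubmonoid.subset_closure (Or.inr ⟨Fin.last m, rfl, rfl⟩)
    have h' : i ≤ (Fin.last m).castSucc :=
      Fin.le_castSucc_iff.mpr (lt_of_le_of_ne (Fin.le_last i) h)
    have := add_mem (sub_mem_cone h') hs
    rwa [← add_assoc, sub_add_cancel] at this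

/-- The case j = i is allowed: 2e_i is not a root, but it occurs in differences of roots in
`IsRational.apply_lt_of_descent`. -/
theorem add_mem_cone {i j : Fin (n + 1)} (h : i ≠ Fin.last n) :
    e i + e j ∈ AddSubmonoid.closure (simpleRoots n) := by
  have := add_mem (add_last_mem_cone h) (sub_mem_cone (Fin.le_last j))
  rwa [add_add_sub_cancel] at this

/-- The sum of the coordinates up to `t`. -/
def partialSum (t : Fin (n + 1)) : V n →ₗ[ℝ] ℝ := ∑ i ∈ Finset.Iic t, LinearMap.proj i

theorem partialSum_e (t i : Fin (n + 1)) : partialSum t (e i) = if i ≤ t then 1 else 0 := by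
  simp [partialSum, e, Pi.single_apply]

theorem partialSum_posRoot_nonneg {x : V n} (hx : x ∈ posRoots n) (t : Fin (n + 1)) :
    0 ≤ partialSum t x := by
  rcases hx with ⟨i, j, h, rfl⟩ | ⟨i, j, h, rfl⟩
  · rw [map_sub, partialSum_e, partialSum_e]
    by_cases hj : j ≤ t
    · simp [hj, h.le.trans hj]
    · simp only [hj, if_false]; split_ifs <;> norm_num
  · rw [map_add, partialSum_e, partialSum_e]
    split_ifs <;> norm_num

theorem simpleRoots_subset_posRoots : simpleRoots n ⊆ posRoots n := by
  rintro x (⟨i, rfl⟩ | ⟨i, -, rfl⟩)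
  · exact posRoot_sub i.castSucc_lt_succ
  · exact posRoot_add i.castSucc_lt_succ.ne

/-- Partial sums are nonnegative on simple roots, hence on the cone they generate. This is the only
necessary condition for the root order that the proof uses. -/
theorem RootLE.partialSum_le {x y : V n} (h : RootLE x y) (t : Fin (n + 1)) :
    partialSum t x ≤ partialSum t y := by
  have key : ∀ z ∈ AddSubmonoid.closure (simpleRoots n), 0 ≤ partialSum t z := by
    intro z hz
    induction hz using AddSubmonoid.closure_induction with
    | mem z hz => exact partialSum_posRoot_nonneg (simpleRoots_subset_posRoots hz) t
    | zero => simp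
    | add z w _ _ hz hw => rw [map_add]; exact add_nonneg hz hw
  have := key _ h
  rw [map_sub] at this
  linarith

/-! ### Criteria for rationality -/

/-- By induction `S` lies in every `nu u k`: the start uses that `adj S` consists of positive roots,
the step that `adj` is monotone. -/
theorem not_isRational_of_subset {u : V n ≃ₗ[ℝ] V n} {S : Set (V n)} (hne : S.Nonempty)
    (hpos : S ⊆ posRoots n) (hS : S ⊆ u '' adj S) : ¬ IsRational u := by
  rintro ⟨-, N, hN⟩
  have key : ∀ k, S ⊆ nu u k := by
    intro k
    induction k with
    | zero =>
      exact fun x hx => ⟨Set.image_mono (fun y hy => hy.1) (hS hx), hpos hx⟩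
    | succ k ih =>
      refine fun x hx => ⟨Set.image_mono ?_ (hS hx), hpos hx⟩
      rintro y ⟨hy, β, hβ, hle⟩
      exact ⟨hy, β, ih hβ, hle⟩
  obtain ⟨x, hx⟩ := hne
  have := key N hx
  rw [hN N le_rfl] at this
  exact this

theorem not_isRational_of_le {u : V n ≃ₗ[ℝ] V n} {x : V n} (hx : x ∈ posRoots n)
    (hux : u x ∈ posRoots n) (hle : RootLE x (u x)) : ¬ IsRational u := by
  refine not_isRational_of_subset (S := {u x}) (Set.singleton_nonempty _) (by simpa using hux) ?_
  rintro _ rfl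
  exact ⟨x, ⟨hx, u x, rfl, hle⟩, rfl⟩

theorem not_isRational_of_le_of_le {u : V n ≃ₗ[ℝ] V n} {x y : V n} (hx : x ∈ posRoots n)
    (hy : y ∈ posRoots n) (hux : u x ∈ posRoots n) (huy : u y ∈ posRoots n)
    (hxy : RootLE x (u y)) (hyx : RootLE y (u x)) : ¬ IsRational u := by
  refine not_isRational_of_subset (S := {u x, u y}) ⟨u x, by simp⟩ ?_ ?_
  · rintro _ (rfl | rfl)
    exacts [hux, huy]
  · rintro _ (rfl | rfl)
    · exact ⟨x, ⟨hx, u y, by simp, hxy⟩, rfl⟩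
    · exact ⟨y, ⟨hy, u x, by simp, hyx⟩, rfl⟩

theorem nu_eq_empty_of_le {u : V n ≃ₗ[ℝ] V n} {N k : ℕ} (h : nu u N = ∅) (hk : N ≤ k) :
    nu u k = ∅ := by
  induction k, hk using Nat.le_induction with
  | base => exact h
  | succ k _ ih =>
    rw [nu, ih]
    simp [adj]

/-! ### Permutations whose only descent below the identity is at the last index -/

/-- `π j ≥ j` for every `j` other than the last index. -/
def IsUp (π : Equiv.Perm (Fin (n + 1))) : Prop := ∀ j, j ≠ Fin.last n → j ≤ π j

/-- Pigeonhole: if x moved up, then i, x and all indices above x except the last would be mapped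
injectively into the indices above x, which are one fewer. -/
theorem IsUp.apply_eq_self {π : Equiv.Perm (Fin (n + 1))} (h : IsUp π) {i x : Fin (n + 1)}
    (hix : i < x) (hx : x < π i) : π x = x := by
  by_contra hne
  have hxl : x ≠ Fin.last n := (hx.trans_le (Fin.le_last _)).ne
  have hlt : x < π x := lt_of_le_of_ne (h x hxl) (Ne.symm hne)
  have hsub : insert i (insert x ((Finset.Ioi x).erase (Fin.last n))) ⊆
      (Finset.Ioi x).map π.symm.toEmbedding := by
    intro y hy
    rw [Finset.mem_map_equiv, Equiv.symm_symm, Finset.mem_Ioi]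
    simp only [Finset.mem_insert, Finset.mem_erase, Finset.mem_Ioi] at hy
    rcases hy with rfl | rfl | ⟨h1, h2⟩
    · exact hx
    · exact hlt
    · exact h2.trans_le (h y h1)
  have hcard := Finset.card_le_card hsub
  rw [Finset.card_map, Finset.card_insert_of_notMem, Finset.card_insert_of_notMem,
    Finset.card_erase_of_mem] at hcard
  · omega
  · exact Finset.mem_Ioi.mpr (lt_of_le_of_ne (Fin.le_last _) hxl)
  · simp
  · simp [hix.ne, hix.le]

/-- Otherwise π would map all indices from a on into those strictly above a. -/
theorem IsUp.apply_last_le {π : Equiv.Perm (Fin (n + 1))} (h : IsUp π) {a : Fin (n + 1)}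
    (ha : a < π a) : π (Fin.last n) ≤ a := by
  by_contra! hlt
  have hsub : insert a (Finset.Ioi a) ⊆ (Finset.Ioi a).map π.symm.toEmbedding := by
    intro y hy
    rw [Finset.mem_map_equiv, Equiv.symm_symm, Finset.mem_Ioi]
    simp only [Finset.mem_insert, Finset.mem_Ioi] at hy
    rcases hy with rfl | hy
    · exact ha
    · by_cases hl : y = Fin.last n
      · rwa [hl]
      · exact hy.trans_le (h y hl)
  have hcard := Finset.card_le_card hsub
  rw [Finset.card_map, Finset.card_insert_of_notMem (by simp)] at hcard
  omega

/-- The indices other than the last one that `π` moves. -/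
def moved (π : Equiv.Perm (Fin (n + 1))) : Finset (Fin n) :=
  Finset.univ.filter fun j => π j.castSucc ≠ j.castSucc

theorem mem_moved {π : Equiv.Perm (Fin (n + 1))} {j : Fin n} :
    j ∈ moved π ↔ π j.castSucc ≠ j.castSucc := by simp [moved]

theorem eq_of_forall_ne_last {π π' : Equiv.Perm (Fin (n + 1))}
    (h : ∀ j, j ≠ Fin.last n → π j = π' j) : π = π' := by
  ext1 j
  by_cases hj : j = Fin.last n
  · by_contra hne
    have h1 : π (π.symm (π' j)) = π' j := by simp
    have h2 : π.symm (π' j) ≠ j := fun h' => hne (by rw [← h1, h'])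
    rw [h _ (hj ▸ h2)] at h1
    exact h2 (π'.injective h1)
  · exact h j hj

/-- If j < π j < π' j, then π' fixes π j by `IsUp.apply_eq_self`; equal moved sets make π fix it
too, so π takes the value π j at both j and π j. -/
theorem IsUp.eq_of_moved_eq {π π' : Equiv.Perm (Fin (n + 1))} (h : IsUp π) (h' : IsUp π')
    (hm : moved π = moved π') : π = π' := by
  have key : ∀ {π π' : Equiv.Perm (Fin (n + 1))}, IsUp π → IsUp π' → moved π = moved π' →
      ∀ j, j ≠ Fin.last n → π' j ≤ π j := by
    intro π π' h h' hm j hj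
    by_contra! hlt
    have hsame : ∀ y, y ≠ Fin.last n → π' y = y → π y = y := by
      intro y hy hfix
      induction y using Fin.lastCases with
      | last => exact absurd rfl hy
      | cast y =>
        by_contra hne
        exact mem_moved.mp (hm ▸ mem_moved.mpr hne) hfix
    have hjlt : j < π j := by
      refine lt_of_le_of_ne (h j hj) fun heq => ?_
      refine hlt.ne ?_
      rw [← heq]
      by_contra hne
      have : π' j ≠ j := fun h => hne h.symm
      induction j using Fin.lastCases with
      | last => exact absurd rfl hj
      | cast j => exact mem_moved.mp (hm ▸ mem_moved.mpr this) heq.symm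
    have hfix := h'.apply_eq_self hjlt hlt
    have := hsame _ (hlt.trans_le (Fin.le_last _)).ne hfix
    exact hjlt.ne (π.injective this).symm
  exact eq_of_forall_ne_last fun j hj =>
    le_antisymm (key h' h hm.symm j hj) (key h h' hm j hj)

theorem cycle_list_pairwise (I : Finset (Fin n)) :
    ((I.sort (· ≤ ·)).map Fin.castSucc ++ [Fin.last n]).Pairwise (· < ·) := by
  rw [List.pairwise_append]
  refine ⟨?_, by simp, ?_⟩
  · rw [List.pairwise_map]
    exact I.sortedLT_sort.pairwise.imp fun h => h
  · simp only [List.mem_map, Finset.mem_sort, List.mem_singleton]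
    rintro _ ⟨i, -, rfl⟩ _ rfl
    exact Fin.castSucc_lt_last i

/-- The cycle sends each list entry to the next one, and the list is strictly increasing and ends at
the last index. -/
theorem lt_p_apply {I : Finset (Fin n)} {i : Fin n} (hi : i ∈ I) :
    i.castSucc < p I i.castSucc := by
  have hpw := cycle_list_pairwise I
  have hmem : i.castSucc ∈ (I.sort (· ≤ ·)).map Fin.castSucc := by simp [hi]
  obtain ⟨k, hk, hk'⟩ := List.getElem_of_mem hmem
  have hlen : k + 1 < ((I.sort (· ≤ ·)).map Fin.castSucc ++ [Fin.last n]).length := by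
    simp only [List.length_append, List.length_singleton]; omega
  have hget : ((I.sort (· ≤ ·)).map Fin.castSucc ++ [Fin.last n])[k] = i.castSucc := by
    rw [List.getElem_append_left hk, hk']
  have h1 := List.formPerm_apply_lt_getElem _ hpw.nodup k hlen
  rw [hget] at h1
  rw [p, h1, ← hget]
  exact List.pairwise_iff_getElem.mp hpw _ _ _ _ (Nat.lt_succ_self k)

theorem p_apply_of_notMem {I : Finset (Fin n)} {i : Fin n} (hi : i ∉ I) :
    p I i.castSucc = i.castSucc :=
  List.formPerm_apply_of_notMem (by simp [hi, Fin.castSucc_ne_last])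

theorem moved_p (I : Finset (Fin n)) : moved (p I) = I := by
  ext i
  rw [mem_moved]
  by_cases hi : i ∈ I
  · simp [hi, (lt_p_apply hi).ne']
  · simp [hi, p_apply_of_notMem hi]

theorem isUp_p (I : Finset (Fin n)) : IsUp (p I) := by
  intro j hj
  induction j using Fin.lastCases with
  | last => exact absurd rfl hj
  | cast i =>
    by_cases hi : i ∈ I
    · exact (lt_p_apply hi).le
    · exact (p_apply_of_notMem hi).ge

theorem IsUp.eq_p {π : Equiv.Perm (Fin (n + 1))} (h : IsUp π) : π = p (moved π) :=
  h.eq_of_moved_eq (isUp_p _) (moved_p _).symm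

theorem p_injective : Function.Injective (p : Finset (Fin n) → Equiv.Perm (Fin (n + 1))) :=
  fun I J h => by rw [← moved_p I, h, moved_p]

theorem p_empty : p (∅ : Finset (Fin n)) = 1 := by simp [p]

theorem p_max' {I : Finset (Fin n)} (h : I.Nonempty) :
    p I (I.max' h).castSucc = Fin.last n := by
  have hlt := lt_p_apply (I.max'_mem h)
  by_contra hne
  obtain ⟨x, hx⟩ := Fin.exists_castSucc_eq.mpr hne
  rw [← hx] at hlt
  have hxI : x ∉ I := fun hxI => (I.le_max' x hxI).not_gt (Fin.castSucc_lt_castSucc_iff.mp hlt)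
  have := p_apply_of_notMem hxI
  rw [hx] at this
  exact hlt.ne ((p I).injective this ▸ hx.symm)

theorem p_last_ne {I : Finset (Fin n)} (h : I.Nonempty) : p I (Fin.last n) ≠ Fin.last n := by
  intro hl
  have := (p I).injective (hl.trans (p_max' h).symm)
  exact Fin.castSucc_ne_last _ this.symm

/-- Toggling `a` in `I` amounts to multiplying `p I` by the transposition of `a` and `a + 1`,
provided `a + 1` lies on the cycle. -/
theorem p_symmDiff {I : Finset (Fin n)} {a : Fin n}
    (h : a.succ = Fin.last n ∨ ∃ b ∈ I, (b : ℕ) = a + 1) :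
    p (symmDiff I {a}) = Equiv.swap a.castSucc a.succ * p I := by
  have hup := isUp_p I
  have hsucc : a.succ ≠ Fin.last n → a.succ < p I a.succ := by
    intro hne
    rcases h with h | ⟨b, hb, hba⟩
    · exact absurd h hne
    · have : a.succ = b.castSucc := by ext; simp [hba]
      rw [this]
      exact lt_p_apply hb
  -- The transposition lowers only the value a + 1, to a. This could break `IsUp` only if a + 1 were
  -- a fixed index other than the last, which `hsucc` excludes.
  have hup' : IsUp (Equiv.swap a.castSucc a.succ * p I) := by
    intro j hj
    have hjp := hup j hj
    rw [Equiv.Perm.mul_apply, Equiv.swap_apply_def]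
    split_ifs with h1 h2
    · exact (h1 ▸ hjp).trans a.castSucc_lt_succ.le
    · rw [Fin.le_castSucc_iff]
      refine lt_of_le_of_ne (h2 ▸ hjp) ?_
      rintro rfl
      exact (hsucc hj).ne' h2
    · exact hjp
  refine ((hup'.eq_p).trans (congrArg p ?_)).symm
  ext j
  rw [mem_moved, Equiv.Perm.mul_apply, Finset.mem_symmDiff, Finset.mem_singleton]
  by_cases hja : j = a
  · subst hja
    simp only [true_and, not_true_eq_false, and_false, false_or]
    by_cases hj : j ∈ I
    · have hlt := lt_p_apply hj
      -- A larger image would leave j + 1 strictly in between, hence fixed, against `hsucc`.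
      have heq : p I j.castSucc = j.succ := by
        by_contra hne
        have hlt' : j.succ < p I j.castSucc :=
          lt_of_le_of_ne (Fin.castSucc_lt_iff_succ_le.mp hlt) (Ne.symm hne)
        have := hup.apply_eq_self j.castSucc_lt_succ hlt'
        exact (hsucc (hlt'.trans_le (Fin.le_last _)).ne).ne' this
      simp [heq, hj]
    · simp [p_apply_of_notMem hj, hj, j.castSucc_lt_succ.ne']
  · have hja' : j.castSucc ≠ a.castSucc := fun h => hja (Fin.castSucc_injective _ h)
    simp only [hja, not_false_eq_true, and_true, false_and, or_false]
    by_cases hj : j ∈ I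
    · simp only [hj, iff_true]
      have hlt := lt_p_apply hj
      intro heq
      rw [Equiv.swap_apply_eq_iff] at heq
      rw [Equiv.swap_apply_def, if_neg hja'] at heq
      split_ifs at heq with h2
      · rw [heq, h2] at hlt
        exact hlt.not_gt a.castSucc_lt_succ
      · exact hlt.ne' heq
    · simp only [hj, iff_false, not_not]
      rw [p_apply_of_notMem hj]
      refine Equiv.swap_apply_of_ne_of_ne hja' fun h2 => ?_
      have h3 := hsucc (h2 ▸ Fin.castSucc_ne_last j)
      rw [← h2, p_apply_of_notMem hj] at h3
      exact h3.false

theorem IsUp.succ_mem_of_swap_mul {I : Finset (Fin n)} {a : Fin n}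
    (h : IsUp (Equiv.swap a.castSucc a.succ * p I)) :
    a.succ = Fin.last n ∨ ∃ b ∈ I, (b : ℕ) = a + 1 := by
  by_contra! hcon
  obtain ⟨hl, hI⟩ := hcon
  obtain ⟨b, hb⟩ := Fin.exists_castSucc_eq.mpr hl
  have hbI : b ∉ I := fun hbI => hI b hbI (by have := congrArg Fin.val hb; simpa using this)
  have := h a.succ hl
  rw [Equiv.Perm.mul_apply, ← hb, p_apply_of_notMem hbI, hb, Equiv.swap_apply_right] at this
  exact this.not_gt a.castSucc_lt_succ

/-! ### Rational elements belong to the family -/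

/-- If π a ≤ a, then e_a + e_r or e_a - e_r, chosen according to the sign at r, has a positive image
above it, unless `u` sends e_r to -e_r. -/
theorem IsRational.lt_apply_of_eq_one {π : Equiv.Perm (Fin (n + 1))} {ε : Fin (n + 1) → ℤˣ}
    (hu : IsRational (signedPerm π ε)) {a : Fin (n + 1)} (ha : a ≠ Fin.last n) (hε : ε a = 1) :
    a < π a := by
  by_contra! hba
  have hal : a < Fin.last n := lt_of_le_of_ne (Fin.le_last a) ha
  have hne : π a ≠ π (Fin.last n) := fun h => ha (π.injective h)
  rcases Int.units_eq_one_or (ε (Fin.last n)) with hl | hl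
  · have him : signedPerm π ε (e a + e (Fin.last n)) = e (π a) + e (π (Fin.last n)) := by
      rw [map_add, signedPerm_e_of_eq_one hε, signedPerm_e_of_eq_one hl]
    refine not_isRational_of_le (posRoot_add ha) (him ▸ posRoot_add hne) ?_ hu
    rw [RootLE, him, add_sub_add_comm]
    exact add_mem (sub_mem_cone hba) (sub_mem_cone (Fin.le_last _))
  · have him : signedPerm π ε (e a - e (Fin.last n)) = e (π a) + e (π (Fin.last n)) := by
      rw [map_sub, signedPerm_e_of_eq_one hε, signedPerm_e_of_eq_neg_one hl, sub_neg_eq_add]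
    by_cases hc : π (Fin.last n) = Fin.last n
    · rw [hc] at him hne
      have him' : signedPerm π ε (e a + e (Fin.last n)) = e (π a) - e (Fin.last n) := by
        rw [map_add, signedPerm_e_of_eq_one hε, signedPerm_e_of_eq_neg_one hl, hc, sub_eq_add_neg]
      -- When e_r ↦ -e_r, each of e_a - e_r and e_a + e_r lies below the image of the other.
      refine not_isRational_of_le_of_le (posRoot_sub hal) (posRoot_add ha)
        (him ▸ posRoot_add hne)
        (him' ▸ posRoot_sub (lt_of_le_of_ne (Fin.le_last _) hne)) ?_ ?_ hu
      · rw [RootLE, him', sub_sub_sub_cancel_right]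
        exact sub_mem_cone hba
      · rw [RootLE, him, add_sub_add_right_eq_sub]
        exact sub_mem_cone hba
    · refine not_isRational_of_le (posRoot_sub hal) (him ▸ posRoot_add hne) ?_ hu
      have hsum : e (π a) + e (π (Fin.last n)) - (e a - e (Fin.last n)) =
          (e (π a) - e a) + (e (π (Fin.last n)) + e (Fin.last n)) := by abel
      rw [RootLE, him, hsum]
      exact add_mem (sub_mem_cone hba) (add_last_mem_cone hc)

/-- If `u e_a = -e_b` with `b < a`, then `u` maps no index of `[b, a)` to `[a, r]`. -/
theorem IsRational.apply_lt_of_descent {π : Equiv.Perm (Fin (n + 1))} {ε : Fin (n + 1) → ℤˣ}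
    (hu : IsRational (signedPerm π ε)) {a i : Fin (n + 1)} (ha : a ≠ Fin.last n)
    (hε : ε a = -1) (hi : π a ≤ i) (hia : i < a) : π i < a := by
  by_contra! hcon
  have hb : π a < π i := (hi.trans_lt hia).trans_le hcon
  rcases Int.units_eq_one_or (ε i) with hεi | hεi
  · have him : signedPerm π ε (e i - e a) = e (π a) + e (π i) := by
      rw [map_sub, signedPerm_e_of_eq_one hεi, signedPerm_e_of_eq_neg_one hε]
      abel
    refine not_isRational_of_le (posRoot_sub hia) (him ▸ posRoot_add hb.ne) ?_ hu
    have hsum : e (π a) + e (π i) - (e i - e a) = (e (π a) - e i) + (e a + e (π i)) := by abel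
    rw [RootLE, him, hsum]
    exact add_mem (sub_mem_cone hi) (add_mem_cone ha)
  · have him : signedPerm π ε (e i - e a) = e (π a) - e (π i) := by
      rw [map_sub, signedPerm_e_of_eq_neg_one hεi, signedPerm_e_of_eq_neg_one hε]
      abel
    refine not_isRational_of_le (posRoot_sub hia) (him ▸ posRoot_sub hb) ?_ hu
    have hsum : e (π a) - e (π i) - (e i - e a) = (e (π a) - e i) + (e a - e (π i)) := by abel
    rw [RootLE, him, hsum]
    exact add_mem (sub_mem_cone hi) (sub_mem_cone hcon)

/-- Strong induction on the value b = π a. If b < a, the interval [b, a] cannot be mapped into [b,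
a), and `IsRational.apply_lt_of_descent` keeps images of [b, a) below a. So some i ≥ b has π i < b,
a descent with a smaller value. -/
theorem IsRational.isUp {π : Equiv.Perm (Fin (n + 1))} {ε : Fin (n + 1) → ℤˣ}
    (hu : IsRational (signedPerm π ε)) : IsUp π := by
  have key : ∀ b a : Fin (n + 1), a ≠ Fin.last n → π a = b → a ≤ b := by
    intro b
    induction b using WellFoundedLT.induction with
    | ind b ih =>
      intro a ha hab
      by_contra! hlt
      have hε : ε a = -1 := by
        refine (Int.units_eq_one_or (ε a)).resolve_left fun h => ?_
        exact (hu.lt_apply_of_eq_one ha h).not_gt (hab ▸ hlt)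
      have hmaps : ∃ i, b ≤ i ∧ i < a ∧ π i < b := by
        by_contra! hcon
        have hsub : (insert a (Finset.Ico b a)).map π.toEmbedding ⊆ Finset.Ico b a := by
          intro y hy
          obtain ⟨i, hi, rfl⟩ := Finset.mem_map.mp hy
          rw [Equiv.coe_toEmbedding, Finset.mem_Ico]
          rw [Finset.mem_insert, Finset.mem_Ico] at hi
          rcases hi with rfl | hi
          · exact ⟨hab.ge, hab.symm ▸ hlt⟩
          · exact ⟨hcon i hi.1 hi.2, hu.apply_lt_of_descent ha hε (hab ▸ hi.1) hi.2⟩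
        have hcard := Finset.card_le_card hsub
        rw [Finset.card_map, Finset.card_insert_of_notMem (by simp)] at hcard
        omega
      obtain ⟨i, hbi, hia, hπ⟩ := hmaps
      have := ih _ hπ i (hia.trans_le (Fin.le_last a)).ne rfl
      exact (this.trans_lt hπ).not_ge hbi
  exact fun j hj => key _ j hj rfl

/-- Since a moves up, π r ≤ a. If π a ≠ r, the image e_{π a} + e_{π r} then lies above e_a ± e_r,
the sign being that of r. -/
theorem IsRational.apply_eq_last {π : Equiv.Perm (Fin (n + 1))} {ε : Fin (n + 1) → ℤˣ}
    (hu : IsRational (signedPerm π ε)) {a : Fin (n + 1)} (ha : a ≠ Fin.last n) (hε : ε a = 1) :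
    π a = Fin.last n := by
  by_contra hb
  have hle := hu.isUp.apply_last_le (hu.lt_apply_of_eq_one ha hε)
  have hne : π a ≠ π (Fin.last n) := fun h => ha (π.injective h)
  rcases Int.units_eq_one_or (ε (Fin.last n)) with hl | hl
  · have him : signedPerm π ε (e a + e (Fin.last n)) = e (π a) + e (π (Fin.last n)) := by
      rw [map_add, signedPerm_e_of_eq_one hε, signedPerm_e_of_eq_one hl]
    refine not_isRational_of_le (posRoot_add ha) (him ▸ posRoot_add hne) ?_ hu
    have hsum : e (π a) + e (π (Fin.last n)) - (e a + e (Fin.last n)) =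
        (e (π (Fin.last n)) - e a) + (e (π a) - e (Fin.last n)) := by abel
    rw [RootLE, him, hsum]
    exact add_mem (sub_mem_cone hle) (sub_mem_cone (Fin.le_last _))
  · have him : signedPerm π ε (e a - e (Fin.last n)) = e (π a) + e (π (Fin.last n)) := by
      rw [map_sub, signedPerm_e_of_eq_one hε, signedPerm_e_of_eq_neg_one hl, sub_neg_eq_add]
    refine not_isRational_of_le (posRoot_sub (lt_of_le_of_ne (Fin.le_last a) ha))
      (him ▸ posRoot_add hne) ?_ hu
    have hsum : e (π a) + e (π (Fin.last n)) - (e a - e (Fin.last n)) =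
        (e (π (Fin.last n)) - e a) + (e (π a) + e (Fin.last n)) := by abel
    rw [RootLE, him, hsum]
    exact add_mem (sub_mem_cone hle) (add_last_mem_cone hb)

/-- The sign vector that is `1` at `x` and `-1` elsewhere. -/
def signAt (x : Fin (n + 1)) : Fin (n + 1) → ℤˣ := fun j => if j = x then 1 else -1

theorem signAt_self (x : Fin (n + 1)) : signAt x x = 1 := if_pos rfl

theorem signAt_of_ne {x j : Fin (n + 1)} (h : j ≠ x) : signAt x j = -1 := if_neg h

theorem prod_signAt (hn : Even n) (x : Fin (n + 1)) : ∏ j, signAt x j = 1 := by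
  rw [← Finset.mul_prod_erase _ _ (Finset.mem_univ x), signAt_self, one_mul,
    Finset.prod_congr rfl fun j hj => signAt_of_ne (Finset.ne_of_mem_erase hj)]
  simp [hn.neg_one_pow]

theorem c_eq (I : Finset (Fin n)) : c I = signedPerm (p I) (signAt (Fin.last n)) := by
  rcases I.eq_empty_or_nonempty with rfl | h
  · rw [c, if_neg (by simp), p_empty]; rfl
  · rw [c, if_pos h]; rfl

theorem d_eq {I : Finset (Fin n)} (h : I.Nonempty) :
    d I = signedPerm (p I) (signAt (I.max' h).castSucc) := by
  rw [d, dif_pos h]; rfl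

theorem d_empty : d (∅ : Finset (Fin n)) = w0 n := by simp [d]

theorem c_empty : c (∅ : Finset (Fin n)) = w0 n := by simp [c]

/-- A rational element is some `c I` or some `d I`. -/
theorem IsRational.exists_eq (hn : Even n) {u : V n ≃ₗ[ℝ] V n} (hu : IsRational u) :
    ∃ I : Finset (Fin n), u = c I ∨ I.Nonempty ∧ u = d I := by
  obtain ⟨π, ε, hε, rfl⟩ := hu.1
  rw [even_iff_prod] at hε
  refine ⟨moved π, ?_⟩
  have hπ : p (moved π) = π := hu.isUp.eq_p.symm
  have hpos : ∀ a, a ≠ Fin.last n → a ≠ π.symm (Fin.last n) → ε a = -1 := by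
    intro a ha ha'
    refine (Int.units_eq_one_or (ε a)).resolve_left fun h => ha' ?_
    rw [Equiv.eq_symm_apply, hu.apply_eq_last ha h]
  -- Both sign vectors have product 1 and agree off x, hence also at x.
  have hcard : ∀ x, (∀ a, a ≠ x → ε a = -1) → ε = signAt x := by
    intro x hx
    have h1 := Finset.mul_prod_erase Finset.univ ε (Finset.mem_univ x)
    have h2 := Finset.mul_prod_erase Finset.univ (signAt x) (Finset.mem_univ x)
    rw [prod_signAt hn, ← hε, ← h1, Finset.prod_congr rfl fun j hj =>
      (hx j (Finset.ne_of_mem_erase hj)).trans (signAt_of_ne (Finset.ne_of_mem_erase hj)).symm,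
      mul_left_inj] at h2
    funext a
    by_cases ha : a = x
    · rw [ha, h2]
    · rw [hx a ha, signAt_of_ne ha]
  rcases (moved π).eq_empty_or_nonempty with hI | hI
  · have hπ1 : π = 1 := by rw [← hπ, hI, p_empty]
    left
    rw [c_eq, hπ, hcard (Fin.last n)]
    intro a ha
    exact hpos a ha (by rw [hπ1]; exact ha)
  · have hmax : ((moved π).max' hI).castSucc = π.symm (Fin.last n) := by
      rw [Equiv.eq_symm_apply]
      exact (Equiv.congr_fun hπ _).symm.trans (p_max' hI)
    rcases Int.units_eq_one_or (ε (Fin.last n)) with hl | hl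
    · rcases Int.units_eq_one_or (ε (π.symm (Fin.last n))) with hq | hq
      -- Two plus signs are impossible: ε would differ from `signAt (Fin.last n)` in exactly one
      -- entry, while both have product 1.
      · exfalso
        have hne : π.symm (Fin.last n) ≠ Fin.last n := hmax ▸ Fin.castSucc_ne_last _
        have h1 := Finset.mul_prod_erase Finset.univ ε (Finset.mem_univ (Fin.last n))
        have h2 := Finset.mul_prod_erase Finset.univ (signAt (Fin.last n))
          (Finset.mem_univ (Fin.last n))
        have hmem : π.symm (Fin.last n) ∈ Finset.univ.erase (Fin.last n) := by simp [hne]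
        rw [hε, hl, one_mul, ← Finset.mul_prod_erase _ _ hmem, hq, one_mul] at h1
        rw [prod_signAt hn, signAt_self, one_mul, ← Finset.mul_prod_erase _ _ hmem,
          signAt_of_ne hne, Finset.prod_congr rfl fun j hj => ?_, h1] at h2
        · exact absurd h2 (by decide)
        · have hj' := Finset.mem_erase.mp hj
          have hj'' := Finset.ne_of_mem_erase hj'.2
          rw [signAt_of_ne hj'', hpos j hj'' hj'.1]
      · left
        rw [c_eq, hπ, hcard (Fin.last n)]
        intro a ha
        by_cases ha' : a = π.symm (Fin.last n)
        · rw [ha', hq]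
        · exact hpos a ha ha'
    · right
      refine ⟨hI, ?_⟩
      rw [d_eq hI, hπ, hmax, hcard (π.symm (Fin.last n))]
      intro a ha
      by_cases ha' : a = Fin.last n
      · rw [ha', hl]
      · exact hpos a ha' ha

/-! ### The elements of the family are rational -/

theorem signedPerm_mem_W (hn : Even n) (π : Equiv.Perm (Fin (n + 1))) (x : Fin (n + 1)) :
    signedPerm π (signAt x) ∈ W n :=
  ⟨π, signAt x, (even_iff_prod _).mpr (prod_signAt hn x), rfl⟩

theorem signAt_last_of_lt {i j : Fin (n + 1)} (h : i < j) : signAt (Fin.last n) i = -1 :=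
  signAt_of_ne (h.trans_le (Fin.le_last j)).ne

theorem partialSum_last_e (i : Fin (n + 1)) : partialSum (Fin.last n) (e i) = 1 := by
  rw [partialSum_e, if_pos (Fin.le_last i)]

theorem partialSum_last_image_nonpos (π : Equiv.Perm (Fin (n + 1))) {x : V n}
    (hx : x ∈ posRoots n) :
    partialSum (Fin.last n) (signedPerm π (signAt (Fin.last n)) x) ≤ 0 := by
  rcases hx with ⟨i, j, h, rfl⟩ | ⟨i, j, h, rfl⟩
  · rw [map_sub, signedPerm_e_of_eq_neg_one (signAt_last_of_lt h), map_sub, map_neg,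
      partialSum_last_e]
    rcases Int.units_eq_one_or (signAt (Fin.last n) j) with hj | hj
    · rw [signedPerm_e_of_eq_one hj, partialSum_last_e]; norm_num
    · rw [signedPerm_e_of_eq_neg_one hj, map_neg, partialSum_last_e]; norm_num
  · rw [map_add, signedPerm_e_of_eq_neg_one (signAt_last_of_lt h), map_add, map_neg,
      partialSum_last_e]
    rcases Int.units_eq_one_or (signAt (Fin.last n) j) with hj | hj
    · rw [signedPerm_e_of_eq_one hj, partialSum_last_e]; norm_num
    · rw [signedPerm_e_of_eq_neg_one hj, map_neg, partialSum_last_e]; norm_num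

/-- If `π` moves every index but the last one up, then `e_i - e_j` stays positive only if
`i < j < π i`, and then it is mapped to `e_j - e_{π i}`. -/
theorem IsUp.sub_image {π : Equiv.Perm (Fin (n + 1))} (hπ : IsUp π) {i j : Fin (n + 1)}
    (hij : i < j) (hpos : signedPerm π (signAt (Fin.last n)) (e i - e j) ∈ posRoots n) :
    j < π i ∧ signedPerm π (signAt (Fin.last n)) (e i - e j) = e j - e (π i) := by
  have hεi := signAt_last_of_lt hij
  have hjl : j ≠ Fin.last n := by
    rintro rfl
    have := partialSum_posRoot_nonneg hpos (Fin.last n)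
    rw [map_sub, signedPerm_e_of_eq_neg_one hεi, signedPerm_e_of_eq_one (signAt_self _),
      map_sub, map_neg, partialSum_last_e, partialSum_last_e] at this
    norm_num at this
  have him : signedPerm π (signAt (Fin.last n)) (e i - e j) = e (π j) - e (π i) := by
    rw [map_sub, signedPerm_e_of_eq_neg_one hεi, signedPerm_e_of_eq_neg_one (signAt_of_ne hjl)]
    abel
  rw [him] at hpos
  -- The partial sum up to π i contains -1 from e_{π i}; to be nonnegative it must also contain e_{π
  -- j}.
  have h1 := partialSum_posRoot_nonneg hpos (π i)
  rw [map_sub, partialSum_e, partialSum_e, if_pos le_rfl] at h1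
  have hle : π j ≤ π i := by
    by_contra hcon
    rw [if_neg hcon] at h1
    norm_num at h1
  have hlt : j < π i := (hπ j hjl).trans_lt
    (lt_of_le_of_ne hle fun h => hij.ne' (π.injective h))
  exact ⟨hlt, by rw [him, hπ.apply_eq_self hij hlt]⟩

/-- Members of `nu u 1` have the form e_j - e_{π i} with i < j < π i. A positive root below one of
these is e_k - e_l with j ≤ k < π i, so π fixes k. But `IsUp.sub_image` lets e_k - e_l stay positive
only if k < l < π k. -/
theorem IsUp.nu_two_eq_empty {π : Equiv.Perm (Fin (n + 1))} (hπ : IsUp π) :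
    nu (signedPerm π (signAt (Fin.last n))) 2 = ∅ := by
  set u := signedPerm π (signAt (Fin.last n)) with hu
  have h1 : ∀ y ∈ nu u 1, ∃ i j, i < j ∧ j < π i ∧ y = e j - e (π i) := by
    rintro y ⟨⟨x, ⟨hx, β, ⟨⟨z, hz, rfl⟩, -⟩, hle⟩, rfl⟩, hy⟩
    have hs := (hle.partialSum_le (Fin.last n)).trans (partialSum_last_image_nonpos π hz)
    rcases hx with ⟨i, j, h, rfl⟩ | ⟨i, j, h, rfl⟩
    · obtain ⟨h2, h3⟩ := hπ.sub_image h hy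
      exact ⟨i, j, h, h2, h3⟩
    · rw [map_add, partialSum_last_e, partialSum_last_e] at hs
      norm_num at hs
  rw [Set.eq_empty_iff_forall_notMem]
  rintro y ⟨⟨x, ⟨hx, β, hβ, hle⟩, rfl⟩, hy⟩
  obtain ⟨i, j, hij, hj, rfl⟩ := h1 β hβ
  rcases hx with ⟨k, l, h, rfl⟩ | ⟨k, l, h, rfl⟩
  · obtain ⟨h2, -⟩ := hπ.sub_image h hy
    have hs := hle.partialSum_le k
    -- At t = k the smaller root has partial sum 1, so e_j must be counted and e_{π i} must not.
    simp only [map_sub, partialSum_e, le_refl, if_true, h.not_ge, if_false, sub_zero] at hs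
    have hjk : j ≤ k := by
      by_contra hcon
      rw [if_neg hcon] at hs
      split_ifs at hs <;> norm_num at hs
    have hki : k < π i := by
      by_contra! hcon
      rw [if_pos hcon, if_pos hjk] at hs
      norm_num at hs
    have := hπ.apply_eq_self (hij.trans_le hjk) hki
    exact (h.trans h2).ne' this
  · have hs := hle.partialSum_le (Fin.last n)
    rw [map_sub, map_add] at hs
    simp only [partialSum_last_e] at hs
    norm_num at hs

theorem isRational_c (hn : Even n) (I : Finset (Fin n)) : IsRational (c I) := by
  rw [c_eq]
  exact ⟨signedPerm_mem_W hn _ _, 2, fun k hk => nu_eq_empty_of_le (isUp_p I).nu_two_eq_empty hk⟩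

/-! ### The diagram automorphism -/

/-- The signs of the diagram automorphism. -/
def flipSign (n : ℕ) : Fin (n + 1) → ℤˣ := fun j => if j = Fin.last n then -1 else 1

theorem flipSign_last : flipSign n (Fin.last n) = -1 := if_pos rfl

theorem flipSign_of_ne {j : Fin (n + 1)} (h : j ≠ Fin.last n) : flipSign n j = 1 := if_neg h

/-- The diagram automorphism `e_r ↦ -e_r` of `D_r`. -/
def flip (n : ℕ) : V n ≃ₗ[ℝ] V n := signedPerm 1 (flipSign n)

theorem flip_apply (x : V n) (i : Fin (n + 1)) :
    flip n x i = ((flipSign n i : ℤ) : ℝ) * x i := rfl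

theorem flip_flip (x : V n) : flip n (flip n x) = x := by
  ext i
  rw [flip_apply, flip_apply]
  rcases Int.units_eq_one_or (flipSign n i) with h | h <;> simp [h]

theorem flip_e_last : flip n (e (Fin.last n)) = -e (Fin.last n) :=
  signedPerm_e_of_eq_neg_one flipSign_last

theorem flip_e_of_ne {j : Fin (n + 1)} (h : j ≠ Fin.last n) : flip n (e j) = e j :=
  signedPerm_e_of_eq_one (flipSign_of_ne h)

theorem flip_mem_posRoots {x : V n} (hx : x ∈ posRoots n) : flip n x ∈ posRoots n := by
  rcases hx with ⟨i, j, h, rfl⟩ | ⟨i, j, h, rfl⟩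
  · rw [map_sub, flip_e_of_ne (h.trans_le (Fin.le_last j)).ne]
    by_cases hj : j = Fin.last n
    · subst hj
      rw [flip_e_last, sub_neg_eq_add]
      exact posRoot_add h.ne
    · rw [flip_e_of_ne hj]
      exact posRoot_sub h
  · rw [map_add, flip_e_of_ne (h.trans_le (Fin.le_last j)).ne]
    by_cases hj : j = Fin.last n
    · subst hj
      rw [flip_e_last, ← sub_eq_add_neg]
      exact posRoot_sub h
    · rw [flip_e_of_ne hj]
      exact posRoot_add h.ne

theorem flip_mem_simpleRoots {x : V n} (hx : x ∈ simpleRoots n) : flip n x ∈ simpleRoots n := by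
  rcases hx with ⟨i, rfl⟩ | ⟨i, h, rfl⟩
  · rw [map_sub, flip_e_of_ne (Fin.castSucc_ne_last i)]
    by_cases hj : i.succ = Fin.last n
    · rw [hj, flip_e_last, sub_neg_eq_add, ← hj]
      exact Or.inr ⟨i, hj, rfl⟩
    · rw [flip_e_of_ne hj]
      exact Or.inl ⟨i, rfl⟩
  · rw [map_add, flip_e_of_ne (Fin.castSucc_ne_last i), h, flip_e_last, ← sub_eq_add_neg, ← h]
    exact Or.inl ⟨i, rfl⟩

theorem RootLE.flip {x y : V n} (h : RootLE x y) : RootLE (flip n x) (flip n y) := by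
  have key : ∀ z ∈ AddSubmonoid.closure (simpleRoots n),
      TypeD.flip n z ∈ AddSubmonoid.closure (simpleRoots n) := by
    intro z hz
    induction hz using AddSubmonoid.closure_induction with
    | mem z hz => exact AddSubmonoid.subset_closure (flip_mem_simpleRoots hz)
    | zero => simp
    | add z w _ _ hz hw => rw [map_add]; exact add_mem hz hw
  have := key _ h
  rwa [map_sub] at this

/-- Conjugation by the diagram automorphism. -/
def conj (u : V n ≃ₗ[ℝ] V n) : V n ≃ₗ[ℝ] V n := flip n * u * flip n

theorem conj_apply (u : V n ≃ₗ[ℝ] V n) (x : V n) : conj u x = flip n (u (flip n x)) := rfl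

theorem conj_conj (u : V n ≃ₗ[ℝ] V n) : conj (conj u) = u := by
  ext1 x
  simp only [conj_apply, flip_flip]

theorem conj_injective : Function.Injective (conj : (V n ≃ₗ[ℝ] V n) → _) :=
  Function.LeftInverse.injective conj_conj

theorem conj_signedPerm (π : Equiv.Perm (Fin (n + 1))) (ε : Fin (n + 1) → ℤˣ) :
    conj (signedPerm π ε) =
      signedPerm π fun j => flipSign n (π j) * (ε j * flipSign n j) := by
  ext1 x
  rw [conj_apply, flip, signedPerm_signedPerm, signedPerm_signedPerm]
  simp only [one_mul, mul_one, Equiv.Perm.one_apply, mul_assoc]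

theorem conj_mem_W {u : V n ≃ₗ[ℝ] V n} (hu : u ∈ W n) : conj u ∈ W n := by
  obtain ⟨π, ε, h, rfl⟩ := hu
  refine ⟨π, _, ?_, conj_signedPerm π ε⟩
  rw [even_iff_prod] at *
  rw [Finset.prod_mul_distrib, Finset.prod_mul_distrib, h, one_mul,
    Equiv.prod_comp π (flipSign n), Int.units_mul_self]

/-- The diagram automorphism preserves positive roots and the root order. One inclusion suffices for
transferring emptiness. -/
theorem nu_conj_subset (u : V n ≃ₗ[ℝ] V n) (k : ℕ) : nu (conj u) k ⊆ flip n '' nu u k := by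
  have key : ∀ {A B : Set (V n)}, (∀ x ∈ A, flip n x ∈ B) →
      conj u '' A ∩ posRoots n ⊆ flip n '' (u '' B ∩ posRoots n) := by
    rintro A B hAB _ ⟨⟨x, hx, rfl⟩, hpos⟩
    refine ⟨u (flip n x), ⟨⟨flip n x, hAB x hx, rfl⟩, ?_⟩, rfl⟩
    rw [conj_apply] at hpos
    simpa only [flip_flip] using flip_mem_posRoots hpos
  induction k with
  | zero => exact key fun x hx => flip_mem_posRoots hx
  | succ k ih =>
    refine key ?_
    rintro x ⟨hx, β, hβ, hle⟩
    obtain ⟨β', hβ', rfl⟩ := ih hβ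
    refine ⟨flip_mem_posRoots hx, β', hβ', ?_⟩
    simpa only [flip_flip] using hle.flip

theorem IsRational.conj {u : V n ≃ₗ[ℝ] V n} (hu : IsRational u) : IsRational (conj u) := by
  obtain ⟨hW, N, hN⟩ := hu
  refine ⟨conj_mem_W hW, N, fun k hk => ?_⟩
  have := nu_conj_subset u k
  rwa [hN k hk, Set.image_empty, Set.subset_empty_iff] at this

/-- Conjugation changes the sign at j exactly when one of j and `p I j`, but not both, is the last
index. For nonempty I this moves the plus sign from the last index to its preimage, the maximum of
I. -/
theorem conj_c (I : Finset (Fin n)) : conj (c I) = d I := by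
  rcases I.eq_empty_or_nonempty with rfl | h
  · rw [c_eq, d_empty, p_empty, conj_signedPerm]
    refine congrArg _ (funext fun j => ?_)
    rw [Equiv.Perm.one_apply, mul_left_comm, Int.units_mul_self, mul_one]
    rfl
  · rw [c_eq, d_eq h, conj_signedPerm]
    refine congrArg _ (funext fun j => ?_)
    have hmax := p_max' h
    by_cases hj : j = (I.max' h).castSucc
    · rw [hj, hmax, flipSign_last, signAt_of_ne (Fin.castSucc_ne_last _),
        flipSign_of_ne (Fin.castSucc_ne_last _), signAt_self]
      decide
    · have hpj : p I j ≠ Fin.last n := fun hpj => hj ((p I).injective (hpj.trans hmax.symm))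
      rw [signAt_of_ne hj, flipSign_of_ne hpj, one_mul]
      by_cases hl : j = Fin.last n
      · rw [hl, signAt_self, flipSign_last, one_mul]
      · rw [signAt_of_ne hl, flipSign_of_ne hl, mul_one]

theorem conj_d (I : Finset (Fin n)) : conj (d I) = c I := by
  rw [← conj_c, conj_conj]

theorem isRational_d (hn : Even n) (I : Finset (Fin n)) : IsRational (d I) :=
  conj_c I ▸ (isRational_c hn I).conj

theorem c_injective : Function.Injective (c : Finset (Fin n) → _) := fun I J h => by
  rw [c_eq, c_eq] at h
  exact p_injective (signedPerm_injective h).1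

theorem d_injective : Function.Injective (d : Finset (Fin n) → _) := fun I J h => by
  rw [← conj_c, ← conj_c] at h
  exact c_injective (conj_injective h)

theorem eq_empty_of_c_eq_d {I J : Finset (Fin n)} (h : c I = d J) : I = ∅ ∧ J = ∅ := by
  rcases J.eq_empty_or_nonempty with rfl | hJ
  · rw [d_empty, ← c_empty] at h
    exact ⟨c_injective h, rfl⟩
  · rw [c_eq, d_eq hJ] at h
    have := congrFun (signedPerm_injective h).2 (Fin.last n)
    rw [signAt_self, signAt_of_ne (Fin.castSucc_ne_last _).symm] at this
    exact absurd this (by decide)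

theorem setOf_isRational (hn : Even n) :
    {u : V n ≃ₗ[ℝ] V n | IsRational u} = Set.range c ∪ d '' {I | I.Nonempty} := by
  ext u
  simp only [Set.mem_ofPred_eq, Set.mem_union, Set.mem_range, Set.mem_image]
  constructor
  · intro hu
    obtain ⟨I, rfl | ⟨hI, rfl⟩⟩ := hu.exists_eq hn
    · exact Or.inl ⟨I, rfl⟩
    · exact Or.inr ⟨I, hI, rfl⟩
  · rintro (⟨I, rfl⟩ | ⟨I, -, rfl⟩)
    · exact isRational_c hn I
    · exact isRational_d hn I

theorem ncard_isRational (hn : Even n) :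
    {u : V n ≃ₗ[ℝ] V n | IsRational u}.ncard = 1 + 2 * (2 ^ n - 1) := by
  have hdisj : Disjoint (Set.range (c : Finset (Fin n) → _)) (d '' {I | I.Nonempty}) := by
    rw [Set.disjoint_left]
    rintro _ ⟨I, rfl⟩ ⟨J, hJ, h⟩
    exact (Set.mem_ofPred_eq ▸ hJ).ne_empty (eq_empty_of_c_eq_d h.symm).2
  have hne : {I : Finset (Fin n) | I.Nonempty} = Set.univ \ {∅} := by
    ext I; simp [Finset.nonempty_iff_ne_empty]
  rw [setOf_isRational hn, Set.ncard_union_eq hdisj (Set.finite_range _) (Set.toFinite _),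
    Set.ncard_image_of_injective _ d_injective, hne, Set.ncard_sdiff_singleton_of_mem (by simp),
    ← Set.image_univ, Set.ncard_image_of_injective _ c_injective, Set.ncard_univ]
  simp only [Nat.card_eq_fintype_card, Fintype.card_finset, Fintype.card_fin]
  have := Nat.one_le_two_pow (n := n)
  omega

/-! ### Simple reflections -/

theorem reflect_sub {i j : Fin (n + 1)} (hij : i ≠ j) (x : V n) :
    reflect (e i - e j) x = fun k => x (Equiv.swap i j k) := by
  have h1 : (e i - e j : V n) ⬝ᵥ (e i - e j) = 2 := by
    simp [e, hij, hij.symm]; norm_num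
  have h2 : x ⬝ᵥ (e i - e j : V n) = x i - x j := by simp [e, dotProduct_sub]
  ext k
  rw [reflect, h1, h2, Equiv.swap_apply_def]
  by_cases hi : k = i
  · subst hi; simp [e, hij]
  · by_cases hj : k = j
    · subst hj; simp [e, hi]
    · simp [e, hi, hj]

/-- The signs are indexed by the source, so left multiplication by a transposition leaves them
alone. -/
theorem reflect_sub_signedPerm {i j : Fin (n + 1)} (hij : i ≠ j)
    (π : Equiv.Perm (Fin (n + 1))) (ε : Fin (n + 1) → ℤˣ) (x : V n) :
    reflect (e i - e j) (signedPerm π ε x) = signedPerm (Equiv.swap i j * π) ε x := by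
  rw [reflect_sub hij]
  ext k
  simp [signedPerm_apply, Equiv.Perm.mul_def]

theorem flip_dotProduct_flip (x y : V n) : flip n x ⬝ᵥ flip n y = x ⬝ᵥ y := by
  refine Finset.sum_congr rfl fun i _ => ?_
  rw [flip_apply, flip_apply]
  rcases Int.units_eq_one_or (flipSign n i) with h | h <;> simp [h]

theorem reflect_flip (α x : V n) : reflect (flip n α) (flip n x) = flip n (reflect α x) := by
  simp only [reflect, flip_dotProduct_flip, map_sub, map_smul]

theorem reflect_reflect {α : V n} (hα : α ⬝ᵥ α ≠ 0) (x : V n) :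
    reflect α (reflect α x) = x := by
  ext k
  simp only [reflect, sub_dotProduct, smul_dotProduct, smul_eq_mul, Pi.sub_apply, Pi.smul_apply]
  field_simp
  ring

theorem simpleRoot_dotProduct_self_ne_zero {α : V n} (hα : α ∈ simpleRoots n) : α ⬝ᵥ α ≠ 0 := by
  rw [Ne, dotProduct_self_eq_zero]
  rcases hα with ⟨i, rfl⟩ | ⟨i, -, rfl⟩ <;> intro h <;>
    have := congrFun h i.castSucc <;> simp [e, i.castSucc_lt_succ.ne] at this

/-- `v` is obtained from `u` by left multiplication by a simple reflection. -/
def Step (u v : V n ≃ₗ[ℝ] V n) : Prop := ∃ α ∈ simpleRoots n, ∀ x, v x = reflect α (u x)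

theorem Step.symm {u v : V n ≃ₗ[ℝ] V n} (h : Step u v) : Step v u := by
  obtain ⟨α, hα, h⟩ := h
  refine ⟨α, hα, fun x => ?_⟩
  rw [h, reflect_reflect (simpleRoot_dotProduct_self_ne_zero hα)]

theorem Step.conj {u v : V n ≃ₗ[ℝ] V n} (h : Step u v) : Step (conj u) (conj v) := by
  obtain ⟨α, hα, h⟩ := h
  refine ⟨flip n α, flip_mem_simpleRoots hα, fun x => ?_⟩
  rw [conj_apply, conj_apply, h, reflect_flip]

/-! ### Edges and valencies of the rationality graph. -/

theorem rationalityGraph_adj {u v : {u : V n ≃ₗ[ℝ] V n // IsRational u}} :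
    (rationalityGraph n).Adj u v ↔ u ≠ v ∧ Step u.1 v.1 := by
  rw [rationalityGraph, SimpleGraph.fromRel_adj]
  exact and_congr_right fun _ => ⟨fun h => h.elim id Step.symm, Or.inl⟩

theorem step_c {I : Finset (Fin n)} {a : Fin n}
    (h : a.succ = Fin.last n ∨ ∃ b ∈ I, (b : ℕ) = a + 1) : Step (c I) (c (symmDiff I {a})) := by
  refine ⟨_, Or.inl ⟨a, rfl⟩, fun x => ?_⟩
  rw [c_eq, c_eq, reflect_sub_signedPerm a.castSucc_lt_succ.ne, p_symmDiff h]

theorem step_d {I : Finset (Fin n)} {a : Fin n}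
    (h : a.succ = Fin.last n ∨ ∃ b ∈ I, (b : ℕ) = a + 1) : Step (d I) (d (symmDiff I {a})) := by
  rw [← conj_c, ← conj_c]
  exact (step_c h).conj

/-- The edges listed in the theorem. -/
def ListedEdge (u v : V n ≃ₗ[ℝ] V n) : Prop :=
  ∃ (I : Finset (Fin n)) (a : Fin n),
    (a.succ = Fin.last n ∨ ∃ b ∈ I, (b : ℕ) = a + 1) ∧
      ((u = c I ∧ v = c (symmDiff I {a})) ∨ (u = d I ∧ v = d (symmDiff I {a})))

theorem ListedEdge.conj {u v : V n ≃ₗ[ℝ] V n} (h : ListedEdge u v) :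
    ListedEdge (conj u) (conj v) := by
  obtain ⟨I, a, ha, ⟨rfl, rfl⟩ | ⟨rfl, rfl⟩⟩ := h
  · exact ⟨I, a, ha, Or.inr ⟨conj_c _, conj_c _⟩⟩
  · exact ⟨I, a, ha, Or.inl ⟨conj_d _, conj_d _⟩⟩

theorem listedEdge_of_step_c (hn : Even n) {I : Finset (Fin n)} {v : V n ≃ₗ[ℝ] V n}
    (h : Step (c I) v) (hv : IsRational v) : ListedEdge (c I) v := by
  obtain ⟨α, ⟨a, rfl⟩ | ⟨a, ha, rfl⟩, h⟩ := h
  · have hva : v = signedPerm (Equiv.swap a.castSucc a.succ * p I) (signAt (Fin.last n)) := by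
      ext1 x
      rw [h, c_eq, reflect_sub_signedPerm a.castSucc_lt_succ.ne]
    have hup := (hva ▸ hv).isUp
    have hsucc := hup.succ_mem_of_swap_mul
    exact ⟨I, a, hsucc, Or.inl ⟨rfl, by rw [hva, c_eq, p_symmDiff hsucc]⟩⟩
  -- The reflection in e_{r-1} + e_r is the conjugate by `flip n` of the reflection in e_{r-1} -
  -- e_r.
  · have hva : v = signedPerm (Equiv.swap a.castSucc a.succ * p I) fun j =>
        flipSign n (Equiv.swap a.castSucc a.succ (p I j)) *
          (flipSign n (p I j) * signAt (Fin.last n) j) := by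
      ext1 x
      have hα : e a.castSucc + e a.succ = flip n (e a.castSucc - e a.succ) := by
        rw [map_sub, flip_e_of_ne (Fin.castSucc_ne_last a), ha, flip_e_last, sub_neg_eq_add]
      rw [h, c_eq, hα, ← flip_flip (signedPerm _ _ x), reflect_flip, flip,
        signedPerm_signedPerm, reflect_sub_signedPerm a.castSucc_lt_succ.ne,
        signedPerm_signedPerm]
      rfl
    obtain ⟨J, hJ | ⟨hJ, hvJ⟩⟩ := hv.exists_eq hn
    · exfalso
      rw [hva, c_eq] at hJ
      have h2 := (signedPerm_injective hJ).2
      -- At the preimage of the last index the reflection reverses the sign, whereas `c I` and `c J`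
      -- have the same sign vector.
      have hq := congrFun h2 ((p I).symm (Fin.last n))
      simp only [Equiv.apply_symm_apply, ← ha, Equiv.swap_apply_right] at hq
      rw [ha, flipSign_of_ne (Fin.castSucc_ne_last a), flipSign_last] at hq
      have hqs : (p I).symm (Fin.last n) = Fin.last n := by
        by_contra hne
        rw [signAt_of_ne hne] at hq
        exact absurd hq (by decide)
      rw [hqs, signAt_self] at hq
      exact absurd hq (by decide)
    · have hI : I = ∅ := by
        rw [hva, d_eq hJ] at hvJ
        obtain ⟨h1, h2⟩ := signedPerm_injective hvJ
        -- The sign of `d J` at the last index is -1, so exactly one of `p I` and `p J` fixes that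
        -- index. `p J` does not, since J is nonempty; hence `p I` does and I is empty.
        have hl := congrFun h2 (Fin.last n)
        rw [signAt_self, signAt_of_ne (Fin.castSucc_ne_last _).symm, mul_one] at hl
        by_contra hne
        have hpl := p_last_ne (Finset.nonempty_iff_ne_empty.mpr hne)
        by_cases hpa : p I (Fin.last n) = a.castSucc
        · refine p_last_ne hJ ?_
          rw [← h1, Equiv.Perm.mul_apply, hpa, Equiv.swap_apply_left, ha]
        · rw [Equiv.swap_apply_of_ne_of_ne hpa (ha ▸ hpl), Int.units_mul_self] at hl
          exact absurd hl (by decide)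
      subst hI
      have hpJ : p J = p (symmDiff ∅ {a}) := by
        rw [p_symmDiff (Or.inl ha)]
        rw [hva, d_eq hJ] at hvJ
        exact (signedPerm_injective hvJ).1.symm
      refine ⟨∅, a, Or.inl ha, Or.inr ⟨by rw [c_empty, d_empty], ?_⟩⟩
      rw [hvJ, p_injective hpJ]

theorem listedEdge_of_step (hn : Even n) {u v : V n ≃ₗ[ℝ] V n} (h : Step u v)
    (hu : IsRational u) (hv : IsRational v) : ListedEdge u v := by
  obtain ⟨I, rfl | ⟨-, rfl⟩⟩ := hu.exists_eq hn
  · exact listedEdge_of_step_c hn h hv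
  · have h' := h.conj
    rw [conj_d] at h'
    have := (listedEdge_of_step_c hn h' hv.conj).conj
    rwa [conj_c, conj_conj] at this

theorem symmDiff_singleton_injective {I : Finset (Fin n)} {a b : Fin n}
    (h : symmDiff I {a} = symmDiff I {b}) : a = b :=
  Finset.singleton_injective (symmDiff_right_injective I h)

theorem symmDiff_singleton_ne (I : Finset (Fin n)) (a : Fin n) : I ≠ symmDiff I {a} := by
  intro h
  have : a ∈ I ↔ a ∈ symmDiff I {a} := by rw [← h]
  simp [Finset.mem_symmDiff] at this

theorem ListedEdge.of_c {I : Finset (Fin n)} {a : Fin n}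
    (h : ListedEdge (c I) (c (symmDiff I {a}))) :
    a.succ = Fin.last n ∨ ∃ b ∈ I, (b : ℕ) = a + 1 := by
  obtain ⟨J, a', ha', ⟨h1, h2⟩ | ⟨h1, h2⟩⟩ := h
  · obtain rfl := c_injective h1
    obtain rfl := symmDiff_singleton_injective (c_injective h2)
    exact ha'
  · obtain ⟨rfl, rfl⟩ := eq_empty_of_c_eq_d h1
    have := (eq_empty_of_c_eq_d h2).2
    exact absurd this.symm (symmDiff_singleton_ne _ _)

theorem ListedEdge.of_d {I : Finset (Fin n)} {a : Fin n}
    (h : ListedEdge (d I) (d (symmDiff I {a}))) :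
    a.succ = Fin.last n ∨ ∃ b ∈ I, (b : ℕ) = a + 1 := by
  have := h.conj
  rw [conj_d, conj_d] at this
  exact this.of_c

theorem succ_mem_iff {I : Finset (Fin n)} {a b : Fin n} (hb : (b : ℕ) = a + 1) :
    (a.succ = Fin.last n ∨ ∃ b ∈ I, (b : ℕ) = a + 1) ↔ b ∈ I := by
  constructor
  · rintro (h | ⟨b', hb', h⟩)
    · have := congrArg Fin.val h
      simp only [Fin.val_succ, Fin.val_last] at this
      omega
    · rwa [show b = b' from Fin.ext (hb.trans h.symm)]
  · exact fun h => Or.inr ⟨b, h, hb⟩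

/-- The neighbours of `c {1}` in the list of edges. -/
theorem ListedEdge.eq_of_c_singleton_zero {v : V n ≃ₗ[ℝ] V n} {z m : Fin n} (hz : (z : ℕ) = 0)
    (hm : m.succ = Fin.last n) (h : ListedEdge (c {z}) v) : v = c (symmDiff {z} {m}) := by
  obtain ⟨J, a, ha, ⟨h1, rfl⟩ | ⟨h1, -⟩⟩ := h
  · obtain rfl := c_injective h1
    rcases ha with ha | ⟨b, hb, hba⟩
    · rw [Fin.succ_injective _ (ha.trans hm.symm)]
    · rw [Finset.mem_singleton.mp hb] at hba
      omega
  · exact absurd (eq_empty_of_c_eq_d h1).1 (Finset.singleton_ne_empty _)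

/-- Apart from `c {1}`, every `c I` has two distinct neighbours. -/
theorem exists_two_steps_c (hn : Even n) {I : Finset (Fin n)} {z m : Fin n} (hz : (z : ℕ) = 0)
    (hm : m.succ = Fin.last n) (hI : I ≠ {z}) :
    ∃ v w, IsRational v ∧ IsRational w ∧ v ≠ w ∧ v ≠ c I ∧ w ≠ c I ∧
      Step (c I) v ∧ Step (c I) w := by
  by_cases h0 : I = ∅
  · subst h0
    have hne := symmDiff_singleton_ne ∅ m
    -- The vertex `w0 n` is both `c ∅` and `d ∅`, so it has a neighbour of each kind.
    refine ⟨c (symmDiff ∅ {m}), d (symmDiff ∅ {m}), isRational_c hn _, isRational_d hn _,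
      fun h => hne (eq_empty_of_c_eq_d h).1.symm, fun h => hne (c_injective h).symm,
      fun h => hne (eq_empty_of_c_eq_d h.symm).2.symm, step_c (Or.inl hm), ?_⟩
    rw [c_empty, ← d_empty]
    exact step_d (Or.inl hm)
  · obtain ⟨b, hb, hb0⟩ : ∃ b ∈ I, (b : ℕ) ≠ 0 := by
      by_contra! hcon
      refine hI (Finset.eq_singleton_iff_nonempty_unique_mem.mpr
        ⟨Finset.nonempty_iff_ne_empty.mpr h0, fun x hx => Fin.ext ?_⟩)
      rw [hcon x hx, hz]
    -- An element b of I other than the first index permits toggling its predecessor, which differs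
    -- from m because b itself is at most m.
    obtain ⟨a, ha⟩ : ∃ a : Fin n, (b : ℕ) = a + 1 := ⟨⟨b - 1, by omega⟩, by simp; omega⟩
    refine ⟨c (symmDiff I {m}), c (symmDiff I {a}), isRational_c hn _, isRational_c hn _,
      fun h => ?_, fun h => symmDiff_singleton_ne I m (c_injective h).symm,
      fun h => symmDiff_singleton_ne I a (c_injective h).symm, step_c (Or.inl hm),
      step_c (Or.inr ⟨b, hb, ha⟩)⟩
    have hma := congrArg Fin.val (symmDiff_singleton_injective (c_injective h))
    have := congrArg Fin.val hm
    simp only [Fin.val_succ, Fin.val_last] at this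
    omega

theorem ncard_neighborSet_eq_one_iff (hn : Even n) {z : Fin n} (hz : (z : ℕ) = 0)
    (u : {u : V n ≃ₗ[ℝ] V n // IsRational u}) :
    ((rationalityGraph n).neighborSet u).ncard = 1 ↔ u.1 = c {z} ∨ u.1 = d {z} := by
  obtain ⟨m, hm⟩ : ∃ m : Fin n, m.succ = Fin.last n :=
    ⟨⟨n - 1, by have := z.2; omega⟩, by ext; simp; have := z.2; omega⟩
  -- Two distinct neighbours already exclude `ncard = 1`, whose singleton characterisation makes
  -- finiteness of the neighbour set irrelevant.
  have two : ∀ v w : V n ≃ₗ[ℝ] V n, IsRational v → IsRational w → v ≠ w → v ≠ u.1 → w ≠ u.1 →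
      Step u.1 v → Step u.1 w → ((rationalityGraph n).neighborSet u).ncard ≠ 1 := by
    intro v w hv hw hvw hvu hwu hsv hsw h1
    obtain ⟨x, hx⟩ := Set.ncard_eq_one.mp h1
    have hv' : (⟨v, hv⟩ : {u : V n ≃ₗ[ℝ] V n // IsRational u}) ∈
        (rationalityGraph n).neighborSet u :=
      rationalityGraph_adj.mpr ⟨fun h => hvu (congrArg Subtype.val h).symm, hsv⟩
    have hw' : (⟨w, hw⟩ : {u : V n ≃ₗ[ℝ] V n // IsRational u}) ∈
        (rationalityGraph n).neighborSet u :=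
      rationalityGraph_adj.mpr ⟨fun h => hwu (congrArg Subtype.val h).symm, hsw⟩
    rw [hx, Set.mem_singleton_iff] at hv' hw'
    exact hvw (congrArg Subtype.val (hv'.trans hw'.symm))
  have one : ∀ v : V n ≃ₗ[ℝ] V n, IsRational v → v ≠ u.1 → Step u.1 v →
      (∀ w, ListedEdge u.1 w → w = v) → ((rationalityGraph n).neighborSet u).ncard = 1 := by
    intro v hv hvu hsv huniq
    refine Set.ncard_eq_one.mpr ⟨⟨v, hv⟩, Set.eq_singleton_iff_unique_mem.mpr ⟨?_, ?_⟩⟩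
    · exact rationalityGraph_adj.mpr ⟨fun h => hvu (congrArg Subtype.val h).symm, hsv⟩
    · intro w hw
      exact Subtype.ext (huniq _
        (listedEdge_of_step hn (rationalityGraph_adj.mp hw).2 u.2 w.2))
  constructor
  · intro h
    by_contra! hcon
    obtain ⟨I, hI | ⟨-, hI⟩⟩ := u.2.exists_eq hn
    · have hIz : I ≠ {z} := fun h' => hcon.1 (h' ▸ hI)
      obtain ⟨v, w, hv, hw, hvw, hvu, hwu, hsv, hsw⟩ := exists_two_steps_c hn hz hm hIz
      rw [← hI] at hvu hwu hsv hsw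
      exact two v w hv hw hvw hvu hwu hsv hsw h
    · have hIz : I ≠ {z} := fun h' => hcon.2 (h' ▸ hI)
      obtain ⟨v, w, hv, hw, hvw, hvu, hwu, hsv, hsw⟩ := exists_two_steps_c hn hz hm hIz
      have hc : c I = conj u.1 := by rw [hI, conj_d]
      have hsv' := hsv.conj
      have hsw' := hsw.conj
      rw [hc, conj_conj] at hsv' hsw'
      refine two (conj v) (conj w) hv.conj hw.conj (fun h => hvw (conj_injective h))
        (fun h => hvu ?_) (fun h => hwu ?_) hsv' hsw' h
      · rw [hc, ← h, conj_conj]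
      · rw [hc, ← h, conj_conj]
  · rintro (h | h)
    · refine one (c (symmDiff {z} {m})) (isRational_c hn _) ?_ ?_ ?_
      · exact fun h' => symmDiff_singleton_ne {z} m (c_injective (h'.trans h)).symm
      · rw [h]; exact step_c (Or.inl hm)
      · intro w hw
        rw [h] at hw
        exact hw.eq_of_c_singleton_zero hz hm
    · refine one (d (symmDiff {z} {m})) (isRational_d hn _) ?_ ?_ ?_
      · exact fun h' => symmDiff_singleton_ne {z} m (d_injective (h'.trans h)).symm
      · rw [h]; exact step_d (Or.inl hm)
      · intro w hw
        rw [h] at hw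
        have := hw.conj
        rw [conj_d] at this
        rw [← conj_conj w, this.eq_of_c_singleton_zero hz hm, conj_c]

end TypeD

theorem theorem1p1 (n : ℕ) (hr : 5 ≤ n + 1) (hodd : Odd (n + 1)) :
    {u : TypeD.V n ≃ₗ[ℝ] TypeD.V n | TypeD.IsRational u} =
      {TypeD.w0 n} ∪ {u | ∃ I : Finset (Fin n), I.Nonempty ∧ (u = TypeD.c I ∨ u = TypeD.d I)} ∧
    {u : TypeD.V n ≃ₗ[ℝ] TypeD.V n | TypeD.IsRational u}.ncard = 1 + 2 * (2 ^ n - 1) ∧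
    {u : TypeD.V n ≃ₗ[ℝ] TypeD.V n | TypeD.IsRational u}.ncard = 2 ^ (n + 1) - 1 ∧
    ∃ (hc : ∀ I : Finset (Fin n), TypeD.IsRational (TypeD.c I))
      (hd : ∀ I : Finset (Fin n), TypeD.IsRational (TypeD.d I)),
      -- toggling `a ≤ r - 2`
      (∀ (I : Finset (Fin n)) (a b : Fin n), (b : ℕ) = a + 1 →
        ((TypeD.rationalityGraph n).Adj ⟨TypeD.c I, hc I⟩
          ⟨TypeD.c (symmDiff I {a}), hc (symmDiff I {a})⟩ ↔ b ∈ I)) ∧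
      (∀ (I : Finset (Fin n)) (a b : Fin n), (b : ℕ) = a + 1 →
        ((TypeD.rationalityGraph n).Adj ⟨TypeD.d I, hd I⟩
          ⟨TypeD.d (symmDiff I {a}), hd (symmDiff I {a})⟩ ↔ b ∈ I)) ∧
      -- toggling `m = r - 1`
      (∀ (I : Finset (Fin n)) (m : Fin n), m.succ = Fin.last n →
        (TypeD.rationalityGraph n).Adj ⟨TypeD.c I, hc I⟩
          ⟨TypeD.c (symmDiff I {m}), hc (symmDiff I {m})⟩ ∧
        (TypeD.rationalityGraph n).Adj ⟨TypeD.d I, hd I⟩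
          ⟨TypeD.d (symmDiff I {m}), hd (symmDiff I {m})⟩) ∧
      -- no other edges
      (∀ u v, (TypeD.rationalityGraph n).Adj u v →
        ∃ (I : Finset (Fin n)) (a : Fin n),
          (a.succ = Fin.last n ∨ ∃ b ∈ I, (b : ℕ) = a + 1) ∧
          ((u.1 = TypeD.c I ∧ v.1 = TypeD.c (symmDiff I {a})) ∨
            (u.1 = TypeD.d I ∧ v.1 = TypeD.d (symmDiff I {a})))) ∧
      -- the vertices of valency one
      (∀ u, ((TypeD.rationalityGraph n).neighborSet u).ncard = 1 ↔
        u.1 = TypeD.c {⟨0, by omega⟩} ∨ u.1 = TypeD.d {⟨0, by omega⟩}) := by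
  have hn : Even n := by
    rcases hodd with ⟨k, hk⟩
    exact ⟨k, by omega⟩
  have hcard := TypeD.ncard_isRational hn
  refine ⟨?_, hcard, ?_, TypeD.isRational_c hn, TypeD.isRational_d hn, ?_, ?_, ?_, ?_, ?_⟩
  · ext u
    rw [TypeD.setOf_isRational hn]
    simp only [Set.mem_union, Set.mem_range, Set.mem_image, Set.mem_ofPred_eq,
      Set.mem_singleton_iff]
    constructor
    · rintro (⟨I, rfl⟩ | ⟨I, hI, rfl⟩)
      · rcases I.eq_empty_or_nonempty with rfl | hI
        · exact Or.inl TypeD.c_empty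
        · exact Or.inr ⟨I, hI, Or.inl rfl⟩
      · exact Or.inr ⟨I, hI, Or.inr rfl⟩
    · rintro (rfl | ⟨I, hI, rfl | rfl⟩)
      · exact Or.inl ⟨∅, TypeD.c_empty⟩
      · exact Or.inl ⟨I, rfl⟩
      · exact Or.inr ⟨I, hI, rfl⟩
  · rw [hcard, pow_succ]
    have := Nat.one_le_two_pow (n := n)
    omega
  · intro I a b hb
    rw [TypeD.rationalityGraph_adj, ← TypeD.succ_mem_iff hb]
    exact ⟨fun h => (TypeD.listedEdge_of_step hn h.2 (TypeD.isRational_c hn _)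
      (TypeD.isRational_c hn _)).of_c, fun h => ⟨fun h' => TypeD.symmDiff_singleton_ne I a
        (TypeD.c_injective (congrArg Subtype.val h')), TypeD.step_c h⟩⟩
  · intro I a b hb
    rw [TypeD.rationalityGraph_adj, ← TypeD.succ_mem_iff hb]
    exact ⟨fun h => (TypeD.listedEdge_of_step hn h.2 (TypeD.isRational_d hn _)
      (TypeD.isRational_d hn _)).of_d, fun h => ⟨fun h' => TypeD.symmDiff_singleton_ne I a
        (TypeD.d_injective (congrArg Subtype.val h')), TypeD.step_d h⟩⟩
  · intro I m hm
    rw [TypeD.rationalityGraph_adj, TypeD.rationalityGraph_adj]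
    exact ⟨⟨fun h' => TypeD.symmDiff_singleton_ne I m
        (TypeD.c_injective (congrArg Subtype.val h')), TypeD.step_c (Or.inl hm)⟩,
      ⟨fun h' => TypeD.symmDiff_singleton_ne I m
        (TypeD.d_injective (congrArg Subtype.val h')), TypeD.step_d (Or.inl hm)⟩⟩
  · intro u v h
    exact TypeD.listedEdge_of_step hn (TypeD.rationalityGraph_adj.mp h).2 u.2 v.2
  · exact fun u => TypeD.ncard_neighborSet_eq_one_iff hn rfl u
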